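/- Let $q\ge 1$ and let $A=(a_1,\dots,a_q)$, $B=(b_1,\dots,b_q)$ be real vectors with $0<a_1\le\cdots\le a_q$, $0<b_1\le\cdots\le b_q$ such that $B$ is weakly supermajorized by $A$, i.e. $\sum_{i=1}^k a_i\le\sum_{i=1}^k b_i$ for $k=1,\dots,q$ (equality for $k=q$ is allowed). Let $0<\sigma\le\min(a_1,\dots,a_q)$. Denote by ${}_{q+1}F_q(\sigma,A;B;z)$ the holomorphic function on $\mathbb{C}\setminus[1,\infty)$ that is equal to $$\sum_{n=0}^\infty\frac{(\sigma)_n(a_1)_n\cdots(a_q)_n}{(b_1)_n\cdots(b_q)_n\,n!}z^n$$ for $|z|<1$, where $(x)_0=1$ and $(x)_n=x(x+1)\cdots(x+n-1)$; in particular, this analytic continuation exists. For $\alpha>0$ let $S_\alpha$ be the class of generalized Stieltjes functions of order $\alpha$, i.e. functions representable in one of the (equivalent) forms $$f(z)=C_1+\int_{[0,\infty)}\frac{\mu(du)}{(u+z)^\alpha}\qquad\text{or}\qquad f(z)=\int_{[0,\infty)}\frac{\rho(dt)}{(1+tz)^\alpha}+\frac{C_2}{z^\alpha}$$ for all $z\in\mathbb{C}\setminus(-\infty,0]$,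 with constants $C_1,C_2\ge0$, non-negative measures $\mu,\rho$ on $[0,\infty)$ for which the integrals converge at all such $z$, and principal branches of the powers. The exact Stieltjes order of a function $f\in\bigcup_{\alpha>0}S_\alpha$ is $\inf\{\alpha>0: f\in S_\alpha\}$. Then $f(z):={}_{q+1}F_q(\sigma,A;B;-z)$ belongs to $S_\sigma$ and its exact Stieltjes order is $\sigma$. In particular, $f$ is real-valued and completely monotonic on $(0,\infty)$: it is infinitely differentiable there and $(-1)^nf^{(n)}(x)\ge0$ for all integers $n\ge0$ and all $x>0$. -/

import Mathlib

open scoped ContDiff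

noncomputable section

/-- The rising factorial `(x)_n = x (x+1) ⋯ (x+n-1)`, with `(x)_0 = 1`. -/
def risingFactorial (x : ℝ) (n : ℕ) : ℝ := (ascPochhammer ℝ n).eval x

/-- The `n`-th Taylor coefficient
`(σ)_n (a_1)_n ⋯ (a_q)_n / ((b_1)_n ⋯ (b_q)_n n!)` of `_{q+1}F_q(σ, A; B; z)`. -/
def hypergeometricCoeff {q : ℕ} (σ : ℝ) (a b : Fin q → ℝ) (n : ℕ) : ℝ :=
  (risingFactorial σ n * ∏ i, risingFactorial (a i) n) /
    ((∏ i, risingFactorial (b i) n) * (n.factorial : ℝ))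

/-- `F` is the generalized hypergeometric function `z ↦ _{q+1}F_q(σ, A; B; z)`:
it is the sum of the hypergeometric series in the open unit disk, and it is holomorphic in
the plane cut along `[1, ∞)`. The identity theorem determines `F` on the cut plane. -/
def IsHypergeometricFunction {q : ℕ} (σ : ℝ) (a b : Fin q → ℝ) (F : ℂ → ℂ) : Prop :=
  DifferentiableOn ℂ F ((fun x : ℝ => (x : ℂ)) '' Set.Ici 1)ᶜ ∧
    ∀ z : ℂ, ‖z‖ < 1 → HasSum (fun n : ℕ => (hypergeometricCoeff σ a b n : ℂ) * z ^ n) (F z)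

/-- The generalized hypergeometric function `_{q+1}F_q(σ, A; B; z)`: the holomorphic
continuation of the hypergeometric series to the plane cut along `[1, ∞)`
(with unspecified values on the cut). -/
def hypergeometricF {q : ℕ} (σ : ℝ) (a b : Fin q → ℝ) : ℂ → ℂ :=
  Classical.epsilon (IsHypergeometricFunction σ a b)

/-- `B = (b_1, …, b_q)` is weakly supermajorized by `A = (a_1, …, a_q)`: both vectors are
positive and arranged in increasing order, and every partial sum of `A` is at most the
corresponding partial sum of `B`. -/
structure WeaklySupermajorized {q : ℕ} (b a : Fin q → ℝ) : Prop where
  pos_a : ∀ i, 0 < a i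
  mono_a : Monotone a
  pos_b : ∀ i, 0 < b i
  mono_b : Monotone b
  sum_le : ∀ k : Fin q, ∑ i ∈ Finset.Iic k, a i ≤ ∑ i ∈ Finset.Iic k, b i

/-- `f(z) = C + ∫_{[0,∞)} μ(du) / (u+z)^α` with `C ≥ 0` and a non-negative measure `μ`, the
integral being convergent for every `z ∈ ℂ ∖ (-∞, 0]`. Powers are principal. -/
def StieltjesFormAdd (α : ℝ) (f : ℂ → ℂ) : Prop :=
  ∃ (C : ℝ) (μ : MeasureTheory.Measure ℝ), 0 ≤ C ∧ ∀ z ∈ Complex.slitPlane,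
    MeasureTheory.IntegrableOn (fun u : ℝ => 1 / ((u : ℂ) + z) ^ (α : ℂ)) (Set.Ici 0) μ ∧
    f z = (C : ℂ) + ∫ u in Set.Ici (0 : ℝ), 1 / ((u : ℂ) + z) ^ (α : ℂ) ∂μ

/-- `f(z) = ∫_{[0,∞)} ρ(dt) / (1+tz)^α + C / z^α` with `C ≥ 0` and a non-negative measure
`ρ`, the integral being convergent for every `z ∈ ℂ ∖ (-∞, 0]`. Powers are principal. -/
def StieltjesFormMul (α : ℝ) (f : ℂ → ℂ) : Prop :=
  ∃ (C : ℝ) (ρ : MeasureTheory.Measure ℝ), 0 ≤ C ∧ ∀ z ∈ Complex.slitPlane,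
    MeasureTheory.IntegrableOn (fun t : ℝ => 1 / (1 + (t : ℂ) * z) ^ (α : ℂ)) (Set.Ici 0) ρ ∧
    f z = (∫ t in Set.Ici (0 : ℝ), 1 / (1 + (t : ℂ) * z) ^ (α : ℂ) ∂ρ) + (C : ℂ) / z ^ (α : ℂ)

/-- The class `S_α`, for `α > 0`, of functions on `ℂ ∖ (-∞, 0]` that are representable in one
of the two forms above (the substitution `u = 1/t` turns either form into the other). -/
def stieltjesClass (α : ℝ) : Set (ℂ → ℂ) :=
  {f | 0 < α ∧ (StieltjesFormAdd α f ∨ StieltjesFormMul α f)}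

/-- `s` is the exact Stieltjes order of `f`: `f` belongs to some `S_α` with `α > 0`, and
`s = inf {α : f ∈ S_α}`. -/
def IsExactStieltjesOrder (f : ℂ → ℂ) (s : ℝ) : Prop :=
  {α : ℝ | f ∈ stieltjesClass α}.Nonempty ∧ IsGLB {α : ℝ | f ∈ stieltjesClass α} s

/-- `g` is completely monotonic on `(0, ∞)`: it is infinitely differentiable there and
`(-1)^n g^{(n)}(x) ≥ 0` for all `n ≥ 0` and `x > 0`. -/
def IsCompletelyMonotonic (g : ℝ → ℝ) : Prop :=
  ContDiffOn ℝ ∞ g (Set.Ioi 0) ∧ ∀ (n : ℕ) (x : ℝ), 0 < x → 0 ≤ (-1) ^ n * iteratedDeriv n g x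

end

/-! The quotients `∏ (a_i)_n / (b_i)_n` are the moments of a finite measure `ρ` on `[0,1]`. Summing
the binomial series under the integral gives `f(z) = ∫ (1 + t z) ^ (-σ) dρ(t)`, which is a Stieltjes
representation of order `σ`; complete monotonicity follows by differentiating under the integral.

For the moments, `j ↦ ∏ Γ(a_i + h j) / Γ(b_i + h j)` is shown to be a completely monotone sequence
(`WeaklySupermajorized.isCMSeq_prod_Gamma_div`). By Euler's limit it reduces to products of `(b_i +
l + h j) / (a_i + l + h j)`; their logarithms are completely monotone by concavity and Abel
summation against the majorization inequalities, and exponentials preserve the property. Hausdorff's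
theorem then supplies the measure.

For the exact order, take a rational `p / N < σ ≤ min a_i`. Sampling the Gamma quotients at step `1
/ N` from `a_i - p / N` shows that `ρ` carries a factor `s ^ (p / N)` near `0`, whence `f(x) ≤ K x ^
(-p / N)` (`WeaklySupermajorized.exists_moment_measure`). A member of `S_α` satisfies `f(x) ≥ x ^
(-α) f(1)` for `x ≥ 1`, so `α < p / N` is impossible. Letting `p / N` approach `σ` excludes every
order below `σ`. -/

open MeasureTheory Filter

/-! ### Completely monotone sequences -/

/-- The negated forward difference of a real sequence. -/
def negDiff (m : ℕ → ℝ) (n : ℕ) : ℝ := m n - m (n + 1)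

/-- The iterated negated differences of `m` of order at most `K` are non-negative. -/
def IsCMUpTo (K : ℕ) (m : ℕ → ℝ) : Prop := ∀ k ≤ K, ∀ n, 0 ≤ (negDiff^[k] m) n

/-- Completely monotone (Hausdorff) sequences. -/
def IsCMSeq (m : ℕ → ℝ) : Prop := ∀ k n, 0 ≤ (negDiff^[k] m) n

theorem isCMSeq_iff_forall_isCMUpTo {m : ℕ → ℝ} : IsCMSeq m ↔ ∀ K, IsCMUpTo K m :=
  ⟨fun h _ k _ n => h k n, fun h k n => h k k le_rfl n⟩

theorem IsCMUpTo.nonneg {K : ℕ} {m : ℕ → ℝ} (h : IsCMUpTo K m) (n : ℕ) : 0 ≤ m n :=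
  h 0 (Nat.zero_le _) n

theorem IsCMUpTo.mono {K L : ℕ} {m : ℕ → ℝ} (h : IsCMUpTo K m) (hL : L ≤ K) : IsCMUpTo L m :=
  fun k hk => h k (hk.trans hL)

theorem isCMUpTo_zero {m : ℕ → ℝ} : IsCMUpTo 0 m ↔ ∀ n, 0 ≤ m n := by
  simp [IsCMUpTo]

theorem isCMUpTo_succ {K : ℕ} {m : ℕ → ℝ} :
    IsCMUpTo (K + 1) m ↔ (∀ n, 0 ≤ m n) ∧ IsCMUpTo K (negDiff m) := by
  constructor
  · intro h
    exact ⟨h.nonneg, fun k hk n => by simpa using h (k + 1) (by omega) n⟩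
  · rintro ⟨h0, h1⟩ k hk n
    rcases k with _ | k
    · exact h0 n
    · simpa using h1 k (by omega) n

theorem IsCMUpTo.shift {K : ℕ} {m : ℕ → ℝ} (h : IsCMUpTo K m) :
    IsCMUpTo K (fun n => m (n + 1)) := by
  induction K generalizing m with
  | zero => exact isCMUpTo_zero.2 fun n => h.nonneg _
  | succ K ih =>
    rw [isCMUpTo_succ] at h ⊢
    exact ⟨fun n => h.1 _, ih h.2⟩

theorem IsCMUpTo.add {K : ℕ} {f g : ℕ → ℝ} (hf : IsCMUpTo K f) (hg : IsCMUpTo K g) :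
    IsCMUpTo K (fun n => f n + g n) := by
  induction K generalizing f g with
  | zero => exact isCMUpTo_zero.2 fun n => add_nonneg (hf.nonneg n) (hg.nonneg n)
  | succ K ih =>
    rw [isCMUpTo_succ] at hf hg ⊢
    refine ⟨fun n => add_nonneg (hf.1 n) (hg.1 n), ?_⟩
    convert ih hf.2 hg.2 using 1
    funext n
    simp only [negDiff]
    ring

/-- Discrete Leibniz rule: the negated difference of `f g` is `Δf(n) g(n) + f(n+1) Δg(n)`. Both
terms are products covered at order `K`, which is why complete monotonicity is graded by order. -/
theorem IsCMUpTo.mul {K : ℕ} {f g : ℕ → ℝ} (hf : IsCMUpTo K f) (hg : IsCMUpTo K g) :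
    IsCMUpTo K (fun n => f n * g n) := by
  induction K generalizing f g with
  | zero => exact isCMUpTo_zero.2 fun n => mul_nonneg (hf.nonneg n) (hg.nonneg n)
  | succ K ih =>
    have hf' := hf.shift.mono K.le_succ
    have hg' := hg.mono K.le_succ
    rw [isCMUpTo_succ] at hf hg ⊢
    refine ⟨fun n => mul_nonneg (hf.1 n) (hg.1 n), ?_⟩
    convert (ih hf.2 hg').add (ih hf' hg.2) using 1
    funext n
    simp only [negDiff]
    ring

theorem isCMUpTo_const (K : ℕ) {c : ℝ} (hc : 0 ≤ c) : IsCMUpTo K (fun _ => c) := by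
  induction K generalizing c with
  | zero => exact isCMUpTo_zero.2 fun _ => hc
  | succ K ih =>
    refine isCMUpTo_succ.2 ⟨fun _ => hc, ?_⟩
    convert ih le_rfl using 1
    funext n
    simp [negDiff]

/-- The negated difference of `1 / (y + h j)` is `h` times the product of the same sequence for `y`
and for `y + h`, so the induction closes under products. -/
theorem isCMUpTo_inv_add_mul (K : ℕ) {h y : ℝ} (hh : 0 ≤ h) (hy : 0 < y) :
    IsCMUpTo K (fun j => (y + h * j)⁻¹) := by
  induction K generalizing y with
  | zero => exact isCMUpTo_zero.2 fun n => by positivity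
  | succ K ih =>
    refine isCMUpTo_succ.2 ⟨fun n => by positivity, ?_⟩
    convert (isCMUpTo_const K hh).mul ((ih hy).mul (ih (add_pos_of_pos_of_nonneg hy hh))) using 1
    funext n
    have h1 : 0 < y + h * n := by positivity
    have h2 : 0 < y + h + h * n := by positivity
    simp only [negDiff]
    push_cast
    rw [show y + h * ((n : ℝ) + 1) = y + h + h * n by ring]
    field_simp
    ring

theorem IsCMSeq.add {f g : ℕ → ℝ} (hf : IsCMSeq f) (hg : IsCMSeq g) :
    IsCMSeq (fun n => f n + g n) := by
  rw [isCMSeq_iff_forall_isCMUpTo] at *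
  exact fun K => (hf K).add (hg K)

theorem IsCMSeq.mul {f g : ℕ → ℝ} (hf : IsCMSeq f) (hg : IsCMSeq g) :
    IsCMSeq (fun n => f n * g n) := by
  rw [isCMSeq_iff_forall_isCMUpTo] at *
  exact fun K => (hf K).mul (hg K)

theorem isCMSeq_const {c : ℝ} (hc : 0 ≤ c) : IsCMSeq (fun _ => c) :=
  isCMSeq_iff_forall_isCMUpTo.2 fun K => isCMUpTo_const K hc

theorem isCMSeq_inv_add_mul {h y : ℝ} (hh : 0 ≤ h) (hy : 0 < y) :
    IsCMSeq (fun j => (y + h * j)⁻¹) :=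
  isCMSeq_iff_forall_isCMUpTo.2 fun K => isCMUpTo_inv_add_mul K hh hy

theorem IsCMSeq.pow {f : ℕ → ℝ} (hf : IsCMSeq f) (k : ℕ) : IsCMSeq (fun n => f n ^ k) := by
  induction k with
  | zero => simpa using isCMSeq_const zero_le_one
  | succ k ih => simpa only [pow_succ] using ih.mul hf

theorem isCMSeq_finset_sum {ι : Type*} (s : Finset ι) {f : ι → ℕ → ℝ}
    (hf : ∀ i ∈ s, IsCMSeq (f i)) : IsCMSeq (fun n => ∑ i ∈ s, f i n) := by
  classical
  induction s using Finset.induction_on with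
  | empty => simpa using isCMSeq_const le_rfl
  | insert i s hi ih =>
    simp only [Finset.sum_insert hi]
    exact (hf i (Finset.mem_insert_self _ _)).add
      (ih fun j hj => hf j (Finset.mem_insert_of_mem hj))

theorem isCMSeq_finset_prod {ι : Type*} (s : Finset ι) {f : ι → ℕ → ℝ}
    (hf : ∀ i ∈ s, IsCMSeq (f i)) : IsCMSeq (fun n => ∏ i ∈ s, f i n) := by
  classical
  induction s using Finset.induction_on with
  | empty => simpa using isCMSeq_const zero_le_one
  | insert i s hi ih =>
    simp only [Finset.prod_insert hi]
    exact (hf i (Finset.mem_insert_self _ _)).mul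
      (ih fun j hj => hf j (Finset.mem_insert_of_mem hj))

theorem tendsto_negDiff_iterate {f : ℕ → ℕ → ℝ} {g : ℕ → ℝ}
    (h : ∀ n, Filter.Tendsto (fun N => f N n) Filter.atTop (nhds (g n))) (k n : ℕ) :
    Filter.Tendsto (fun N => (negDiff^[k] (f N)) n) Filter.atTop (nhds ((negDiff^[k] g) n)) := by
  induction k generalizing n with
  | zero => exact h n
  | succ k ih =>
    simp only [Function.iterate_succ_apply']
    exact (ih n).sub (ih (n + 1))

theorem IsCMSeq.of_tendsto {f : ℕ → ℕ → ℝ} {g : ℕ → ℝ} (hf : ∀ N, IsCMSeq (f N))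
    (h : ∀ n, Filter.Tendsto (fun N => f N n) Filter.atTop (nhds (g n))) : IsCMSeq g :=
  fun k n => ge_of_tendsto' (tendsto_negDiff_iterate h k n) fun N => hf N k n

/-- The Taylor polynomials of `exp` have non-negative coefficients, and pointwise limits preserve
complete monotonicity. -/
theorem IsCMSeq.exp {f : ℕ → ℝ} (hf : IsCMSeq f) : IsCMSeq (fun n => Real.exp (f n)) := by
  refine IsCMSeq.of_tendsto (f := fun N n => ∑ k ∈ Finset.range N, f n ^ k / k.factorial)
    (fun N => isCMSeq_finset_sum _ fun k _ => ?_) fun n => ?_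
  · simp only [div_eq_mul_inv]
    exact (hf.pow k).mul (isCMSeq_const (by positivity))
  · rw [Real.exp_eq_exp_ℝ]
    exact (NormedSpace.expSeries_div_hasSum_exp (f n)).tendsto_sum_nat

theorem negDiff_iterate_finset_sum {ι : Type*} (s : Finset ι) (f : ι → ℕ → ℝ) (k n : ℕ) :
    (negDiff^[k] (fun j => ∑ i ∈ s, f i j)) n = ∑ i ∈ s, (negDiff^[k] (f i)) n := by
  induction k generalizing n with
  | zero => rfl
  | succ k ih => simp only [Function.iterate_succ_apply', negDiff, ih, Finset.sum_sub_distrib]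

theorem negDiff_iterate_sub (f g : ℕ → ℝ) (k n : ℕ) :
    (negDiff^[k] (fun j => f j - g j)) n = (negDiff^[k] f) n - (negDiff^[k] g) n := by
  induction k generalizing n with
  | zero => rfl
  | succ k ih => simp only [Function.iterate_succ_apply', negDiff, ih]; ring

/-! ### Hausdorff moment theorem via Bernstein polynomials -/

/-- The linear functional on polynomials sending `X ^ n` to `m n`. -/
noncomputable def momentFunctional (m : ℕ → ℝ) : Polynomial ℝ →ₗ[ℝ] ℝ :=
  Polynomial.lsum fun n => (m n) • LinearMap.id

theorem momentFunctional_X_pow (m : ℕ → ℝ) (n : ℕ) :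
    momentFunctional m (Polynomial.X ^ n) = m n := by
  simp [momentFunctional, Polynomial.X_pow_eq_monomial, Polynomial.lsum_apply]

theorem momentFunctional_X_pow_mul_one_sub_X_pow (m : ℕ → ℝ) (n k : ℕ) :
    momentFunctional m (Polynomial.X ^ n * (1 - Polynomial.X) ^ k) = (negDiff^[k] m) n := by
  induction k generalizing n with
  | zero => simp [momentFunctional_X_pow]
  | succ k ih =>
    rw [Function.iterate_succ_apply', negDiff, ← ih, ← ih, ← map_sub]
    congr 1
    ring

/-- The image of the Bernstein polynomial of index `(n, k)` under the moment functional. -/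
noncomputable def bernsteinWeight (m : ℕ → ℝ) (n k : ℕ) : ℝ :=
  n.choose k * (negDiff^[n - k] m) k

/-- Apply the moment functional to the polynomial identity that follows from `C(k,j) C(n,k) = C(n,j)
C(n-j,k-j)` and the binomial expansion of `(X + (1 - X)) ^ (n - j) = 1`. -/
theorem sum_choose_mul_bernsteinWeight (m : ℕ → ℝ) {n j : ℕ} (hj : j ≤ n) :
    ∑ k ∈ Finset.range (n + 1), (k.choose j : ℝ) * bernsteinWeight m n k =
      n.choose j * m j := by
  have hpoly : ∑ k ∈ Finset.range (n + 1), ((k.choose j : ℝ) * n.choose k) •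
      ((Polynomial.X : Polynomial ℝ) ^ k * (1 - Polynomial.X) ^ (n - k)) =
      (n.choose j : ℝ) • Polynomial.X ^ j := by
    obtain ⟨d, rfl⟩ := Nat.exists_eq_add_of_le hj
    rw [show j + d + 1 = j + (d + 1) by ring, Finset.sum_range_add]
    rw [Finset.sum_eq_zero (s := Finset.range j), zero_add]
    · have h1 : ((Polynomial.X : Polynomial ℝ) + (1 - Polynomial.X)) ^ d = 1 := by simp
      rw [add_pow] at h1
      have h2 : (Polynomial.X : Polynomial ℝ) ^ j = Polynomial.X ^ j *
          ∑ k ∈ Finset.range (d + 1), Polynomial.X ^ k * (1 - Polynomial.X) ^ (d - k) *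
            (d.choose k : Polynomial ℝ) := by rw [h1, mul_one]
      rw [h2, Finset.mul_sum, Finset.smul_sum]
      refine Finset.sum_congr rfl fun k hk => ?_
      have hk' : k ≤ d := by simpa [Nat.lt_succ_iff] using hk
      have hc := Nat.choose_mul (n := j + d) (k := j + k) (s := j)
      rw [show j + d - j = d by omega, show j + k - j = k by omega] at hc
      have hc' : ((j + k).choose j : ℝ) * (j + d).choose (j + k) =
          (j + d).choose j * d.choose k := by
        rw [mul_comm]; exact_mod_cast hc (by omega)
      rw [hc', show j + d - (j + k) = d - k by omega, pow_add, mul_smul]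
      congr 1
      rw [Polynomial.smul_eq_C_mul]
      simp
      ring
    · intro k hk
      simp [Nat.choose_eq_zero_of_lt (Finset.mem_range.1 hk)]
  have := congrArg (momentFunctional m) hpoly
  rw [map_sum, map_smul, momentFunctional_X_pow] at this
  simp only [map_smul, momentFunctional_X_pow_mul_one_sub_X_pow, smul_eq_mul] at this
  rw [← this]
  exact Finset.sum_congr rfl fun k _ => by rw [bernsteinWeight]; ring

theorem sum_bernsteinWeight (m : ℕ → ℝ) (n : ℕ) :
    ∑ k ∈ Finset.range (n + 1), bernsteinWeight m n k = m 0 := by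
  simpa using sum_choose_mul_bernsteinWeight m (Nat.zero_le n)

theorem exists_abs_prod_sub_pow_le (j : ℕ) : ∃ C : ℝ, 0 ≤ C ∧ ∀ n : ℕ, 0 < n →
    ∀ x ∈ Set.Icc (0 : ℝ) 1, |∏ i ∈ Finset.range j, (x - i / n) - x ^ j| ≤ C / n := by
  induction j with
  | zero => exact ⟨0, le_rfl, fun n _ x _ => by simp⟩
  | succ j ih =>
    obtain ⟨C, hC, h⟩ := ih
    refine ⟨C * (1 + j) + j, by positivity, fun n hn x hx => ?_⟩
    have hn' : (1 : ℝ) ≤ n := by exact_mod_cast hn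
    have hjn : (j : ℝ) / n ≤ j := div_le_self (by positivity) hn'
    have hjn0 : 0 ≤ (j : ℝ) / n := by positivity
    have h1 := h n hn x hx
    have h2 : |x - j / n| ≤ 1 + j := by
      rw [abs_le]; constructor <;> linarith [hx.1, hx.2]
    have h3 : |x ^ j * (j / n)| ≤ j / n := by
      rw [abs_of_nonneg (mul_nonneg (pow_nonneg hx.1 _) hjn0)]
      exact mul_le_of_le_one_left hjn0 (pow_le_one₀ hx.1 hx.2)
    rw [Finset.prod_range_succ]
    set P := ∏ i ∈ Finset.range j, (x - i / n)
    calc |P * (x - j / n) - x ^ (j + 1)|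
        = |(P - x ^ j) * (x - j / n) - x ^ j * (j / n)| := by congr 1; ring
      _ ≤ |(P - x ^ j) * (x - j / n)| + |x ^ j * (j / n)| := abs_sub _ _
      _ ≤ C / n * (1 + j) + j / n := by
          rw [abs_mul]
          gcongr
      _ = (C * (1 + j) + j) / n := by ring

theorem prod_range_div_sub_div (n k j : ℕ) :
    ∏ i ∈ Finset.range j, ((k : ℝ) / n - i / n) = j.factorial * k.choose j / n ^ j := by
  have h : (j.factorial : ℝ) * k.choose j = ∏ i ∈ Finset.range j, ((k : ℝ) - i) := by
    rw [← Nat.cast_mul, ← Nat.descFactorial_eq_factorial_mul_choose,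
      ← descPochhammer_eval_eq_descFactorial ℝ, descPochhammer_eval_eq_prod_range]
  rw [h, ← Finset.card_range j, ← Finset.prod_const, Finset.card_range, ← Finset.prod_div_distrib]
  exact Finset.prod_congr rfl fun i _ => by ring

theorem IsCMSeq.bernsteinWeight_nonneg {m : ℕ → ℝ} (hm : IsCMSeq m) (n k : ℕ) :
    0 ≤ bernsteinWeight m n k := mul_nonneg (by positivity) (hm _ _)

/-- Replacing `x ^ j` by the scaled falling factorial `P` costs `O(1/n)` uniformly on `[0,1]`, and
for `P` the weighted sum is exactly `P 1 * m j`. -/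
theorem IsCMSeq.tendsto_sum_bernsteinWeight {m : ℕ → ℝ} (hm : IsCMSeq m) (j : ℕ) :
    Tendsto (fun n : ℕ => ∑ k ∈ Finset.range (n + 1), ((k : ℝ) / n) ^ j * bernsteinWeight m n k)
      atTop (nhds (m j)) := by
  obtain ⟨C, hC, h⟩ := exists_abs_prod_sub_pow_le j
  rw [tendsto_iff_dist_tendsto_zero]
  have hlim : Tendsto (fun n : ℕ => (C * m 0 + C * |m j|) / (n : ℝ)) atTop (nhds 0) :=
    tendsto_const_div_atTop_nhds_zero_nat _
  refine squeeze_zero' (Eventually.of_forall fun _ => dist_nonneg) ?_ hlim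
  filter_upwards [eventually_ge_atTop (j + 1)] with n hn
  have hn0 : 0 < n := by omega
  have hn0' : (0 : ℝ) < n := by exact_mod_cast hn0
  set P : ℝ → ℝ := fun x => ∏ i ∈ Finset.range j, (x - i / n)
  have hS : ∑ k ∈ Finset.range (n + 1), P (k / n) * bernsteinWeight m n k = P 1 * m j := by
    have h1 : P 1 = j.factorial * n.choose j / n ^ j := by
      rw [← prod_range_div_sub_div, div_self hn0'.ne']
    have h2 : ∀ k : ℕ, P (k / n) = j.factorial / n ^ j * k.choose j := fun k => by
      simp only [P]; rw [prod_range_div_sub_div]; ring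
    simp only [h2, mul_assoc]
    rw [← Finset.mul_sum, sum_choose_mul_bernsteinWeight m (by omega), h1]
    ring
  have e1 : |∑ k ∈ Finset.range (n + 1), ((k : ℝ) / n) ^ j * bernsteinWeight m n k - P 1 * m j| ≤
      C * m 0 / n := by
    rw [← hS, ← Finset.sum_sub_distrib]
    refine (Finset.abs_sum_le_sum_abs _ _).trans ?_
    calc _ ≤ ∑ k ∈ Finset.range (n + 1), C / n * bernsteinWeight m n k := by
          refine Finset.sum_le_sum fun k hk => ?_
          rw [← sub_mul, abs_mul, abs_of_nonneg (hm.bernsteinWeight_nonneg n k), abs_sub_comm]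
          refine mul_le_mul_of_nonneg_right (h n hn0 _ ⟨by positivity, ?_⟩)
            (hm.bernsteinWeight_nonneg n k)
          rw [div_le_one hn0']
          exact_mod_cast Nat.lt_succ_iff.1 (Finset.mem_range.1 hk)
      _ = C * m 0 / n := by rw [← Finset.mul_sum, sum_bernsteinWeight]; ring
  have e2 : |P 1 * m j - m j| ≤ C * |m j| / n := by
    rw [show P 1 * m j - m j = (P 1 - 1 ^ j) * m j by ring, abs_mul]
    calc _ ≤ C / n * |m j| :=
          mul_le_mul_of_nonneg_right (h n hn0 1 ⟨zero_le_one, le_rfl⟩) (abs_nonneg _)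
      _ = _ := by ring
  rw [Real.dist_eq]
  calc _ ≤ _ := abs_sub_le _ (P 1 * m j) _
    _ ≤ C * m 0 / n + C * |m j| / n := add_le_add e1 e2
    _ = _ := by ring

/-- **Hausdorff moment theorem**: a completely monotone sequence with `m 0 = 1` is the moment
sequence of a probability measure on the unit interval. -/
theorem IsCMSeq.exists_probabilityMeasure {m : ℕ → ℝ} (hm : IsCMSeq m) (hm0 : m 0 = 1) :
    ∃ μ : ProbabilityMeasure unitInterval,
      ∀ n, ∫ t, (t : ℝ) ^ n ∂(μ : Measure unitInterval) = m n := by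
  have hpt : ∀ n k : ℕ, (k ≤ n) → (k : ℝ) / n ∈ unitInterval := fun n k hk =>
    ⟨by positivity, div_le_one_of_le₀ (by exact_mod_cast hk) (by positivity)⟩
  let pt : ℕ → ℕ → unitInterval := fun n k => Set.projIcc 0 1 zero_le_one ((k : ℝ) / n)
  have hpt' : ∀ n k : ℕ, k ≤ n → ((pt n k : unitInterval) : ℝ) = (k : ℝ) / n := fun n k hk => by
    simp only [pt]; rw [Set.projIcc_of_mem _ (hpt n k hk)]
  let ν : ℕ → Measure unitInterval := fun n =>
    ∑ k ∈ Finset.range (n + 1), ENNReal.ofReal (bernsteinWeight m n k) • Measure.dirac (pt n k)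
  have hν : ∀ n, IsProbabilityMeasure (ν n) := fun n => ⟨by
    simp only [ν, Measure.coe_finsetSum, Finset.sum_apply, Measure.smul_apply, measure_univ,
      smul_eq_mul, mul_one]
    rw [← ENNReal.ofReal_sum_of_nonneg fun k _ => hm.bernsteinWeight_nonneg n k,
      sum_bernsteinWeight, hm0, ENNReal.ofReal_one]⟩
  have hint : ∀ n j, ∫ t, (t : ℝ) ^ j ∂(ν n) =
      ∑ k ∈ Finset.range (n + 1), ((k : ℝ) / n) ^ j * bernsteinWeight m n k := fun n j => by
    simp only [ν]
    rw [integral_finsetSum_measure]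
    · refine Finset.sum_congr rfl fun k hk => ?_
      rw [integral_smul_measure, integral_dirac, hpt' n k (by simpa [Nat.lt_succ_iff] using hk),
        ENNReal.toReal_ofReal (hm.bernsteinWeight_nonneg n k), smul_eq_mul, mul_comm]
    · intro k _
      exact (integrable_dirac (by simp)).smul_measure ENNReal.ofReal_ne_top
  let ν' : ℕ → ProbabilityMeasure unitInterval := fun n => ⟨ν n, hν n⟩
  -- Probability measures on a compact space form a compact space, so an ultrafilter finer than
  -- `atTop` has a limit and no subsequence need be extracted.
  let U : Ultrafilter ℕ := Ultrafilter.of atTop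
  have hU : (U : Filter ℕ) ≤ atTop := Ultrafilter.of_le _
  obtain ⟨μ, -, hμ⟩ := isCompact_univ.ultrafilter_le_nhds (U.map ν') (by simp)
  have hμ' : Tendsto ν' U (nhds μ) := hμ
  refine ⟨μ, fun j => ?_⟩
  let f : C(unitInterval, ℝ) := ⟨fun t => (t : ℝ) ^ j, by fun_prop⟩
  have h1 := ((ProbabilityMeasure.continuous_integral_continuousMap f).tendsto μ).comp hμ'
  have h2 := (hm.tendsto_sum_bernsteinWeight j).mono_left hU
  refine tendsto_nhds_unique h1 (h2.congr fun n => ?_)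
  rw [← hint]
  rfl

/-! ### From majorization to Gamma quotients -/

theorem hasDerivAt_negDiff_iterate {G : ℕ → ℝ → ℝ} {g : ℕ → ℝ} {y : ℝ}
    (h : ∀ j, HasDerivAt (G j) (g j) y) (k n : ℕ) :
    HasDerivAt (fun y => (negDiff^[k] (fun j => G j y)) n) ((negDiff^[k] g) n) y := by
  induction k generalizing n with
  | zero => exact h n
  | succ k ih =>
    simp only [Function.iterate_succ_apply', negDiff]
    exact (ih n).sub (ih (n + 1))

theorem negDiff_iterate_inv_antitone {h y z : ℝ} (hh : 0 ≤ h) (hy : 0 < y) (hyz : y ≤ z)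
    (k n : ℕ) : (negDiff^[k] (fun j => (z + h * j)⁻¹)) n ≤
      (negDiff^[k] (fun j => (y + h * j)⁻¹)) n := by
  rw [← sub_nonneg, ← negDiff_iterate_sub]
  have hz := hy.trans_le hyz
  convert ((isCMSeq_const (sub_nonneg.2 hyz)).mul
    ((isCMSeq_inv_add_mul hh hy).mul (isCMSeq_inv_add_mul hh hz))) k n using 3 with j
  have h1 : 0 < y + h * j := by positivity
  have h2 : 0 < z + h * j := by positivity
  field_simp
  ring

/-- Tangent-line inequality at `y` for a concave function: the differenced logarithm has as
derivative the differenced reciprocal, which is antitone. -/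
theorem negDiff_iterate_inv_mul_sub_le {h x y : ℝ} (hh : 0 ≤ h) (hx : 0 < x) (hy : 0 < y)
    (k n : ℕ) : (negDiff^[k] (fun j => (y + h * j)⁻¹)) n * (y - x) ≤
      (negDiff^[k] (fun j => Real.log (y + h * j))) n -
        (negDiff^[k] (fun j => Real.log (x + h * j))) n := by
  have hd : ∀ z : ℝ, 0 < z → HasDerivAt (fun y => (negDiff^[k] (fun j => Real.log (y + h * j))) n)
      ((negDiff^[k] (fun j => (z + h * j)⁻¹)) n) z := fun z hz => by
    refine hasDerivAt_negDiff_iterate (G := fun j y => Real.log (y + h * j)) (fun j => ?_) k n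
    have := ((hasDerivAt_id z).add_const (h * j)).log (by simp only [id]; positivity)
    simpa using this
  rcases lt_trichotomy x y with hxy | rfl | hxy
  · obtain ⟨c, hc, hc'⟩ := exists_hasDerivAt_eq_slope _ _ hxy
      (fun z hz => (hd z (hx.trans_le hz.1)).continuousAt.continuousWithinAt)
      fun z hz => hd z (hx.trans hz.1)
    rw [eq_div_iff (sub_pos.2 hxy).ne'] at hc'
    rw [← hc']
    exact mul_le_mul_of_nonneg_right
      (negDiff_iterate_inv_antitone hh (hx.trans hc.1) hc.2.le k n) (sub_pos.2 hxy).le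
  · simp
  · obtain ⟨c, hc, hc'⟩ := exists_hasDerivAt_eq_slope _ _ hxy
      (fun z hz => (hd z (hy.trans_le hz.1)).continuousAt.continuousWithinAt)
      fun z hz => hd z (hy.trans hz.1)
    rw [eq_div_iff (sub_pos.2 hxy).ne'] at hc'
    have := mul_le_mul_of_nonneg_right
      (negDiff_iterate_inv_antitone hh hy hc.1.le k n) (sub_pos.2 hxy).le
    linarith

/-- Abel summation, done by subtracting the last weight from all others. Since that weight is
non-negative, the total sum of `d` need not vanish: weak majorization suffices. -/
theorem sum_mul_nonneg_of_antitone {q : ℕ} {w d : Fin q → ℝ} (hw : Antitone w)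
    (hw0 : ∀ i, 0 ≤ w i) (hd : ∀ k, 0 ≤ ∑ i ∈ Finset.Iic k, d i) : 0 ≤ ∑ i, w i * d i := by
  induction q with
  | zero => simp
  | succ q ih =>
    have h1 := ih (w := fun i => w i.castSucc - w (Fin.last q)) (d := fun i => d i.castSucc)
      (fun i j hij => sub_le_sub_right (hw (Fin.castSucc_le_castSucc_iff.2 hij)) _)
      (fun i => sub_nonneg.2 (hw (Fin.le_last _))) fun k => by
        have := hd k.castSucc
        rw [← Fin.map_castSuccEmb_Iic, Finset.sum_map] at this
        exact this
    have h2 : 0 ≤ ∑ i, d i := by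
      have := hd (Fin.last q)
      rwa [← Fin.top_eq_last, Finset.Iic_top] at this
    have h3 := mul_nonneg (hw0 (Fin.last q)) h2
    rw [Fin.sum_univ_castSucc] at h3 ⊢
    simp only [sub_mul, Finset.sum_sub_distrib, ← Finset.mul_sum] at h1
    linarith

/-- The shift may be negative; positivity of `b i + c` comes from the first partial sum, which
bounds the smallest `b` below by the smallest `a`. -/
theorem WeaklySupermajorized.add_const {q : ℕ} {a b : Fin q → ℝ} (hba : WeaklySupermajorized b a)
    {c : ℝ} (hc : ∀ i, 0 < a i + c) :
    WeaklySupermajorized (fun i => b i + c) (fun i => a i + c) where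
  pos_a := hc
  mono_a := hba.mono_a.add_const c
  pos_b i := by
    have hq : 0 < q := i.pos
    have h0 := hba.sum_le ⟨0, hq⟩
    have hI : Finset.Iic (⟨0, hq⟩ : Fin q) = {⟨0, hq⟩} := by
      ext j; simp [Fin.le_def, Fin.ext_iff]
    rw [hI, Finset.sum_singleton, Finset.sum_singleton] at h0
    have h1 : b ⟨0, hq⟩ ≤ b i := hba.mono_b (Fin.le_def.2 (Nat.zero_le _))
    linarith [hc ⟨0, hq⟩]
  mono_b := hba.mono_b.add_const c
  sum_le k := by
    simp only [Finset.sum_add_distrib]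
    exact add_le_add_left (hba.sum_le k) _

theorem WeaklySupermajorized.isCMSeq_prod_div {q : ℕ} {a b : Fin q → ℝ}
    (hba : WeaklySupermajorized b a) {h : ℝ} (hh : 0 ≤ h) :
    IsCMSeq (fun j => ∏ i, (b i + h * j) / (a i + h * j)) := by
  have hlog : IsCMSeq (fun j => ∑ i, (Real.log (b i + h * j) - Real.log (a i + h * j))) := by
    intro k n
    rw [negDiff_iterate_finset_sum]
    simp only [negDiff_iterate_sub]
    -- The tangents are taken at `b i`, so the slopes decrease in `i` and pair with the partial sums
    -- of `b - a`.
    refine (sum_mul_nonneg_of_antitone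
      (w := fun i => (negDiff^[k] (fun j => (b i + h * j)⁻¹)) n) (d := fun i => b i - a i)
      (fun i j hij => negDiff_iterate_inv_antitone hh (hba.pos_b i) (hba.mono_b hij) k n)
      (fun i => isCMSeq_inv_add_mul hh (hba.pos_b i) k n) fun k => ?_).trans
      (Finset.sum_le_sum fun i _ =>
        negDiff_iterate_inv_mul_sub_le hh (hba.pos_a i) (hba.pos_b i) k n)
    rw [Finset.sum_sub_distrib]
    exact sub_nonneg.2 (hba.sum_le k)
  convert hlog.exp using 1
  funext j
  rw [Real.exp_sum]
  refine Finset.prod_congr rfl fun i _ => ?_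
  have h1 := hba.pos_a i
  have h2 := hba.pos_b i
  rw [Real.exp_sub, Real.exp_log (by positivity), Real.exp_log (by positivity)]

theorem WeaklySupermajorized.isCMSeq_prod_Gamma_div {q : ℕ} {a b : Fin q → ℝ}
    (hba : WeaklySupermajorized b a) {h : ℝ} (hh : 0 ≤ h) :
    IsCMSeq (fun j => ∏ i, Real.Gamma (a i + h * j) / Real.Gamma (b i + h * j)) := by
  refine IsCMSeq.of_tendsto (f := fun N j => ∏ i, Real.GammaSeq (a i + h * j) (N + 1) /
    Real.GammaSeq (b i + h * j) (N + 1)) (fun N => ?_) fun j => ?_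
  -- In the quotient of Euler approximants the factor `(N + 1) ^ (h * j)` cancels, leaving a
  -- constant times a finite product of shifted quotients.
  · have key : IsCMSeq fun j => (∏ i, ((N + 1 : ℕ) : ℝ) ^ (a i - b i)) *
        ∏ l ∈ Finset.range (N + 1 + 1), ∏ i, (b i + l + h * j) / (a i + l + h * j) :=
      (isCMSeq_const (Finset.prod_nonneg fun i _ => by positivity)).mul
        (isCMSeq_finset_prod _ fun l _ => (hba.add_const (c := l) fun i =>
          add_pos_of_pos_of_nonneg (hba.pos_a i) l.cast_nonneg).isCMSeq_prod_div hh)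
    convert key using 1
    funext j
    rw [Finset.prod_comm, ← Finset.prod_mul_distrib]
    refine Finset.prod_congr rfl fun i _ => ?_
    have h1 := hba.pos_a i
    have h2 := hba.pos_b i
    have hN : (0 : ℝ) < ((N + 1 : ℕ) : ℝ) := by positivity
    rw [Finset.prod_div_distrib, Real.GammaSeq, Real.GammaSeq, Real.rpow_sub hN,
      Real.rpow_add hN, Real.rpow_add hN]
    have e : ∀ x : ℝ, ∏ l ∈ Finset.range (N + 1 + 1), (x + h * j + l) =
        ∏ l ∈ Finset.range (N + 1 + 1), (x + l + h * j) := fun x =>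
      Finset.prod_congr rfl fun l _ => by ring
    rw [e, e]
    have p1 : 0 < ∏ l ∈ Finset.range (N + 1 + 1), (a i + l + h * j) :=
      Finset.prod_pos fun l _ => by positivity
    have p2 : 0 < ∏ l ∈ Finset.range (N + 1 + 1), (b i + l + h * j) :=
      Finset.prod_pos fun l _ => by positivity
    have p3 : (0 : ℝ) < (N + 1).factorial := by positivity
    have p4 := Real.rpow_pos_of_pos hN (a i)
    have p5 := Real.rpow_pos_of_pos hN (b i)
    have p6 := Real.rpow_pos_of_pos hN (h * j)
    field_simp
  · refine tendsto_finsetProd _ fun i _ => ?_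
    have h2 := hba.pos_b i
    exact ((Real.GammaSeq_tendsto_Gamma _).comp (tendsto_add_atTop_nat 1)).div
      ((Real.GammaSeq_tendsto_Gamma _).comp (tendsto_add_atTop_nat 1))
      (Real.Gamma_pos_of_pos (by positivity)).ne'

/-! ### The representing measure and its decay at the origin -/

theorem risingFactorial_eq_Gamma_div {x : ℝ} (hx : 0 < x) (n : ℕ) :
    risingFactorial x n = Real.Gamma (x + n) / Real.Gamma x := by
  have hG := (Real.Gamma_pos_of_pos hx).ne'
  induction n with
  | zero => simp [risingFactorial, hG]
  | succ n ih =>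
    have hxn : 0 < x + n := by positivity
    rw [risingFactorial] at ih ⊢
    rw [ascPochhammer_succ_eval, ih, Nat.cast_succ, ← add_assoc, Real.Gamma_add_one hxn.ne']
    ring

theorem risingFactorial_pos {x : ℝ} (hx : 0 < x) (n : ℕ) : 0 < risingFactorial x n :=
  ascPochhammer_pos n x hx

theorem WeaklySupermajorized.exists_probabilityMeasure {q : ℕ} {a b : Fin q → ℝ}
    (hba : WeaklySupermajorized b a) {N p : ℕ} (hN : 0 < N) (hp : ∀ i, (p : ℝ) / N < a i) :
    ∃ μ : ProbabilityMeasure unitInterval, ∃ c : ℝ, 0 < c ∧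
      ∀ n, ∫ t, (t : ℝ) ^ (N * n + p) ∂(μ : Measure unitInterval) =
        c * ∏ i, risingFactorial (a i) n / risingFactorial (b i) n := by
  have hN' : (N : ℝ) ≠ 0 := by positivity
  -- Start at `a i - p / N` and step by `1 / N`: index `p` lands on `a i` and index `N * n + p` on
  -- `a i + n`.
  set φ : ℕ → ℝ := fun j => ∏ i, Real.Gamma (a i + -((p : ℝ) / N) + (N : ℝ)⁻¹ * j) /
    Real.Gamma (b i + -((p : ℝ) / N) + (N : ℝ)⁻¹ * j) with hφ
  have hba' := hba.add_const (c := -((p : ℝ) / N)) fun i => by linarith [hp i]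
  have hcm : IsCMSeq φ := hba'.isCMSeq_prod_Gamma_div (by positivity)
  have hpos : ∀ j, 0 < φ j := fun j => Finset.prod_pos fun i _ => by
    have h1 := hba'.pos_a i
    have h2 := hba'.pos_b i
    exact div_pos (Real.Gamma_pos_of_pos (by positivity)) (Real.Gamma_pos_of_pos (by positivity))
  have hcm' : IsCMSeq fun j => (φ 0)⁻¹ * φ j := (isCMSeq_const (inv_pos.2 (hpos 0)).le).mul hcm
  obtain ⟨μ, hμ⟩ := hcm'.exists_probabilityMeasure (inv_mul_cancel₀ (hpos 0).ne')
  refine ⟨μ, (φ 0)⁻¹ * φ p, mul_pos (inv_pos.2 (hpos 0)) (hpos p), fun n => ?_⟩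
  rw [hμ, mul_assoc]
  congr 1
  simp only [hφ]
  rw [← Finset.prod_mul_distrib]
  refine Finset.prod_congr rfl fun i _ => ?_
  have e1 : ∀ x : ℝ, x + -((p : ℝ) / N) + (N : ℝ)⁻¹ * p = x := fun x => by field_simp; ring
  have e2 : ∀ x : ℝ, x + -((p : ℝ) / N) + (N : ℝ)⁻¹ * ((N * n + p : ℕ) : ℝ) = x + n := fun x => by
    push_cast; field_simp; ring
  have ha := hba.pos_a i
  have hb := hba.pos_b i
  rw [e1, e1, e2, e2, risingFactorial_eq_Gamma_div ha, risingFactorial_eq_Gamma_div hb]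
  have g1 := Real.Gamma_pos_of_pos ha
  have g2 := Real.Gamma_pos_of_pos hb
  have g3 : 0 < Real.Gamma (b i + n) := Real.Gamma_pos_of_pos (by positivity)
  field_simp

/-- Weight `μ` by `c⁻¹ t ^ p` and push it forward under `s = t ^ N`. The weight equals `c⁻¹ s ^ (p /
N)`, and `(s x) ^ (p / N) ≤ (1 + s x) ^ σ` gives the decay with `K = c⁻¹`. -/
theorem WeaklySupermajorized.exists_moment_measure {q : ℕ} {a b : Fin q → ℝ}
    (hba : WeaklySupermajorized b a) {σ : ℝ} {N p : ℕ} (hN : 0 < N)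
    (hp : ∀ i, (p : ℝ) / N < a i) (hpσ : (p : ℝ) / N ≤ σ) :
    ∃ ρ : Measure unitInterval, IsFiniteMeasure ρ ∧
      (∀ n, ∫ t, (t : ℝ) ^ n ∂ρ = ∏ i, risingFactorial (a i) n / risingFactorial (b i) n) ∧
      ∃ K : ℝ, ∀ x : ℝ, 0 < x →
        ∫ t : unitInterval, (1 + (t : ℝ) * x) ^ (-σ) ∂ρ ≤ K * x ^ (-((p : ℝ) / N)) := by
  obtain ⟨μ, c, hc, hμ⟩ := hba.exists_probabilityMeasure hN hp
  let g : unitInterval → ℝ := fun t => c⁻¹ * (t : ℝ) ^ p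
  have hg0 : ∀ t, 0 ≤ g t := fun t => mul_nonneg (inv_pos.2 hc).le (pow_nonneg t.2.1 _)
  have hgc : Continuous g := by fun_prop
  have hgi : Integrable g (μ : Measure unitInterval) :=
    hgc.integrable_of_hasCompactSupport (HasCompactSupport.of_compactSpace _)
  let ψ : unitInterval → unitInterval := fun t => t ^ N
  have hψ : Continuous ψ := by fun_prop
  let ρ := ((μ : Measure unitInterval).withDensity fun t => ENNReal.ofReal (g t)).map ψ
  have hfin : IsFiniteMeasure ((μ : Measure unitInterval).withDensity
      fun t => ENNReal.ofReal (g t)) := isFiniteMeasure_withDensity_ofReal hgi.2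
  have hint : ∀ f : unitInterval → ℝ, Continuous f →
      ∫ t, f t ∂ρ = ∫ t, g t * f (t ^ N) ∂(μ : Measure unitInterval) := fun f hf => by
    simp only [ρ]
    rw [integral_map hψ.aemeasurable hf.aestronglyMeasurable,
      integral_withDensity_eq_integral_toReal_smul (by fun_prop) (by simp)]
    simp only [ENNReal.toReal_ofReal (hg0 _), smul_eq_mul, ψ]
  refine ⟨ρ, inferInstance, fun n => ?_, c⁻¹, fun x hx => ?_⟩
  · rw [hint _ (by fun_prop)]
    have : ∀ t : unitInterval, g t * ((t ^ N : unitInterval) : ℝ) ^ n =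
        c⁻¹ * (t : ℝ) ^ (N * n + p) := fun t => by
      simp only [g]; push_cast; ring
    simp only [this]
    rw [integral_const_mul, hμ, ← mul_assoc, inv_mul_cancel₀ hc.ne', one_mul]
  · have hpos : ∀ t : unitInterval, 0 < 1 + (t : ℝ) * x := fun t =>
      add_pos_of_pos_of_nonneg one_pos (mul_nonneg t.2.1 hx.le)
    have hcont : Continuous fun t : unitInterval => (1 + (t : ℝ) * x) ^ (-σ) :=
      Continuous.rpow_const (by fun_prop) fun t => Or.inl (hpos t).ne'
    rw [hint _ hcont]
    have hb : ∀ t : unitInterval, g t * (1 + ((t ^ N : unitInterval) : ℝ) * x) ^ (-σ) ≤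
        c⁻¹ * x ^ (-((p : ℝ) / N)) := fun t => by
      simp only [g]
      rw [mul_assoc]
      refine mul_le_mul_of_nonneg_left ?_ (inv_pos.2 hc).le
      have hP := hpos (t ^ N)
      rw [Real.rpow_neg hP.le, Real.rpow_neg hx.le, ← div_eq_mul_inv, div_le_iff₀ (by positivity),
        ← div_eq_inv_mul, le_div_iff₀ (by positivity)]
      have hy : 0 ≤ (t : ℝ) ^ N * x := mul_nonneg (pow_nonneg t.2.1 _) hx.le
      have e : (t : ℝ) ^ p * x ^ ((p : ℝ) / N) = ((t : ℝ) ^ N * x) ^ ((p : ℝ) / N) := by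
        rw [Real.mul_rpow (pow_nonneg t.2.1 _) hx.le, ← Real.rpow_natCast, ← Real.rpow_natCast,
          ← Real.rpow_mul t.2.1, mul_div_cancel₀]
        positivity
      rw [e]
      push_cast
      calc _ ≤ (1 + (t : ℝ) ^ N * x) ^ ((p : ℝ) / N) :=
            Real.rpow_le_rpow hy (by linarith) (by positivity)
        _ ≤ _ := Real.rpow_le_rpow_of_exponent_le (by linarith) hpσ
    calc _ ≤ ∫ _, c⁻¹ * x ^ (-((p : ℝ) / N)) ∂(μ : Measure unitInterval) := by
          refine integral_mono ?_ (integrable_const _) hb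
          exact (hgc.mul (hcont.comp hψ)).integrable_of_hasCompactSupport
            (HasCompactSupport.of_compactSpace _)
      _ = _ := by simp

/-! ### Analytic continuation by a kernel integral -/

theorem mem_cutPlane_iff {z : ℂ} :
    z ∈ ((fun x : ℝ => (x : ℂ)) '' Set.Ici 1)ᶜ ↔ 1 - z ∈ Complex.slitPlane := by
  rw [← not_iff_not, Set.notMem_compl_iff, Complex.mem_slitPlane_iff_not_le_zero, not_not]
  constructor
  · rintro ⟨x, hx, rfl⟩
    rw [← Complex.ofReal_one, ← Complex.ofReal_sub, ← Complex.ofReal_zero, Complex.real_le_real]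
    linarith [Set.mem_Ici.1 hx]
  · intro h
    rw [Complex.le_def] at h
    simp only [Complex.sub_re, Complex.one_re, Complex.zero_re, Complex.sub_im, Complex.one_im,
      Complex.zero_im] at h
    exact ⟨z.re, Set.mem_Ici.2 (by linarith [h.1]), by apply Complex.ext <;> simp; linarith [h.2]⟩

theorem isOpen_cutPlane : IsOpen ((fun x : ℝ => (x : ℂ)) '' Set.Ici 1)ᶜ := by
  have : ((fun x : ℝ => (x : ℂ)) '' Set.Ici 1)ᶜ = (fun z : ℂ => 1 - z) ⁻¹' Complex.slitPlane :=
    Set.ext fun z => mem_cutPlane_iff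
  rw [this]
  exact Complex.isOpen_slitPlane.preimage (by fun_prop)

theorem isPreconnected_cutPlane : IsPreconnected ((fun x : ℝ => (x : ℂ)) '' Set.Ici 1)ᶜ := by
  have : ((fun x : ℝ => (x : ℂ)) '' Set.Ici 1)ᶜ = (fun z : ℂ => 1 - z) '' Complex.slitPlane := by
    ext z
    rw [mem_cutPlane_iff]
    exact ⟨fun h => ⟨1 - z, h, by ring⟩, by rintro ⟨w, hw, rfl⟩; simpa using hw⟩
  rw [this]
  exact (Complex.starConvex_one_slitPlane.isPathConnected
    Complex.one_mem_slitPlane).isConnected.isPreconnected.image _ (by fun_prop)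

/-- Uniqueness of the continuation lets the same `hypergeometricF` be represented by the measures
built from different `p / N`. -/
theorem IsHypergeometricFunction.eqOn {q : ℕ} {σ : ℝ} {a b : Fin q → ℝ} {F G : ℂ → ℂ}
    (hF : IsHypergeometricFunction σ a b F) (hG : IsHypergeometricFunction σ a b G) :
    Set.EqOn F G ((fun x : ℝ => (x : ℂ)) '' Set.Ici 1)ᶜ := by
  refine (hF.1.analyticOnNhd isOpen_cutPlane).eqOn_of_preconnected_of_eventuallyEq
    (hG.1.analyticOnNhd isOpen_cutPlane) isPreconnected_cutPlane (z₀ := 0)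
    (mem_cutPlane_iff.2 (by simp)) ?_
  filter_upwards [Metric.ball_mem_nhds (0 : ℂ) one_pos] with z hz
  have hz' : ‖z‖ < 1 := by simpa using hz
  exact (hF.2 z hz').unique (hG.2 z hz')

theorem one_sub_mul_mem_slitPlane {z : ℂ} (hz : 1 - z ∈ Complex.slitPlane) (t : unitInterval) :
    1 - (t : ℝ) * z ∈ Complex.slitPlane := by
  have := Complex.starConvex_one_slitPlane hz (a := 1 - (t : ℝ)) (b := (t : ℝ))
    (by linarith [t.2.2]) t.2.1 (by ring)
  convert this using 1
  simp only [Complex.real_smul]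
  push_cast
  ring

theorem integrable_unitInterval_of_continuous {ρ : Measure unitInterval} [IsFiniteMeasure ρ]
    {E : Type*} [NormedAddCommGroup E] {f : unitInterval → E} (hf : Continuous f) :
    Integrable f ρ :=
  hf.integrable_of_hasCompactSupport (HasCompactSupport.of_compactSpace _)

theorem continuous_pow_mul_one_sub_cpow (k : ℕ) (β : ℂ) {z : ℂ} (hz : 1 - z ∈ Complex.slitPlane) :
    Continuous fun t : unitInterval => ((t : ℝ) : ℂ) ^ k * (1 - (t : ℝ) * z) ^ β :=
  Continuous.mul (by fun_prop)
    (Continuous.cpow (by fun_prop) continuous_const (one_sub_mul_mem_slitPlane hz))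

/-- The Stieltjes-type kernel integral `∫ t ^ k (1 - t z) ^ β dρ(t)` over the unit interval. -/
noncomputable def kernelIntegral (ρ : Measure unitInterval) (k : ℕ) (β : ℂ) (z : ℂ) : ℂ :=
  ∫ t : unitInterval, ((t : ℝ) : ℂ) ^ k * (1 - (t : ℝ) * z) ^ β ∂ρ

/-- Differentiation raises `k` and lowers `β`, so the family is stable. The dominating constant
comes from compactness of `[0,1]` times a closed ball in the cut plane. -/
theorem hasDerivAt_kernelIntegral (ρ : Measure unitInterval) [IsFiniteMeasure ρ] (k : ℕ) (β : ℂ)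
    {z : ℂ} (hz : 1 - z ∈ Complex.slitPlane) :
    HasDerivAt (kernelIntegral ρ k β) (-β * kernelIntegral ρ (k + 1) (β - 1) z) z := by
  have hU : {w : ℂ | 1 - w ∈ Complex.slitPlane} ∈ nhds z :=
    (Complex.isOpen_slitPlane.preimage (by fun_prop : Continuous fun w : ℂ => 1 - w)).mem_nhds hz
  obtain ⟨ε, hε, hball⟩ := Metric.nhds_basis_closedBall.mem_iff.1 hU
  let F' : ℂ → unitInterval → ℂ := fun w t =>
    -β * (((t : ℝ) : ℂ) ^ (k + 1) * (1 - (t : ℝ) * w) ^ (β - 1))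
  have hcont : ContinuousOn (fun x : unitInterval × ℂ => F' x.2 x.1)
      (Set.univ ×ˢ Metric.closedBall z ε) := by
    refine ContinuousOn.mul continuousOn_const (ContinuousOn.mul (by fun_prop) ?_)
    exact ContinuousOn.cpow (by fun_prop) continuousOn_const fun x hx =>
      one_sub_mul_mem_slitPlane (hball hx.2) x.1
  obtain ⟨C, hC⟩ := (isCompact_univ.prod (isCompact_closedBall z ε)).exists_bound_of_continuousOn
    hcont
  have key := (hasDerivAt_integral_of_dominated_loc_of_deriv_le (μ := ρ) (x₀ := z)
    (F := fun w t => ((t : ℝ) : ℂ) ^ k * (1 - (t : ℝ) * w) ^ β) (F' := F') (bound := fun _ => C)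
    (Metric.closedBall_mem_nhds z hε)
    (by
      filter_upwards [hU] with w hw
      exact (continuous_pow_mul_one_sub_cpow k β hw).aestronglyMeasurable)
    (integrable_unitInterval_of_continuous (continuous_pow_mul_one_sub_cpow k β hz))
    ((continuous_pow_mul_one_sub_cpow (k + 1) (β - 1) hz).const_mul (-β)).aestronglyMeasurable
    (Eventually.of_forall fun t w hw => hC (t, w) ⟨Set.mem_univ _, hw⟩)
    (integrable_const C)
    (Eventually.of_forall fun t w hw => by
      have h1 : HasDerivAt (fun w : ℂ => 1 - (t : ℝ) * w) (-((t : ℝ) : ℂ)) w := by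
        simpa using ((hasDerivAt_id w).const_mul ((t : ℝ) : ℂ)).const_sub 1
      refine ((h1.cpow_const (c := β) (one_sub_mul_mem_slitPlane (hball hw) t)).const_mul
        (((t : ℝ) : ℂ) ^ k)).congr_deriv ?_
      simp only [F']
      ring)).2
  exact key.congr_deriv (integral_const_mul _ _)

theorem choose_eq_risingFactorial_div (σ : ℝ) (n : ℕ) :
    Ring.choose ((σ : ℂ) + n - 1) n = ((risingFactorial σ n / n.factorial : ℝ) : ℂ) := by
  have h : Ring.choose (σ + n - 1) n = risingFactorial σ n / n.factorial := by
    rw [← Ring.multichoose_eq, eq_div_iff (by positivity), mul_comm, ← nsmul_eq_mul,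
      Ring.factorial_nsmul_multichoose_eq_ascPochhammer, Polynomial.ascPochhammer_smeval_eq_eval,
      risingFactorial]
  rw [← h, Complex.ofReal_choose]
  push_cast
  rfl

theorem hasSum_one_sub_cpow (σ : ℝ) {w : ℂ} (hw : ‖w‖ < 1) :
    HasSum (fun n : ℕ => ((risingFactorial σ n / n.factorial : ℝ) : ℂ) * w ^ n)
      ((1 - w) ^ (-(σ : ℂ))) := by
  have h := (Complex.one_div_one_sub_cpow_hasFPowerSeriesOnBall_zero σ).hasSum (y := w)
    (by simpa [← ofReal_norm, ENNReal.ofReal_lt_one] using hw)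
  simp only [FormalMultilinearSeries.ofScalars_apply_eq, zero_add, smul_eq_mul,
    choose_eq_risingFactorial_div, one_div, ← Complex.cpow_neg] at h
  exact h

theorem isHypergeometricFunction_kernelIntegral {q : ℕ} {σ : ℝ} {a b : Fin q → ℝ}
    {ρ : Measure unitInterval} [IsFiniteMeasure ρ] (hσ : 0 < σ)
    (hρ : ∀ n, ∫ t, (t : ℝ) ^ n ∂ρ = ∏ i, risingFactorial (a i) n / risingFactorial (b i) n) :
    IsHypergeometricFunction σ a b (kernelIntegral ρ 0 (-(σ : ℂ))) := by
  refine ⟨fun z hz => (hasDerivAt_kernelIntegral ρ 0 _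
    (mem_cutPlane_iff.1 hz)).differentiableAt.differentiableWithinAt, fun z hz => ?_⟩
  set c : ℕ → ℝ := fun n => risingFactorial σ n / n.factorial with hc
  have hc0 : ∀ n, 0 ≤ c n := fun n => div_nonneg (risingFactorial_pos hσ n).le (by positivity)
  have htz : ∀ t : unitInterval, ‖((t : ℝ) : ℂ) * z‖ < 1 := fun t => by
    rw [norm_mul, Complex.norm_real, Real.norm_of_nonneg t.2.1]
    exact (mul_le_of_le_one_left (norm_nonneg z) t.2.2).trans_lt hz
  have hsum : Summable fun n => c n * ‖z‖ ^ n := by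
    have := (hasSum_one_sub_cpow σ (w := (‖z‖ : ℂ)) (by simpa using hz)).summable.norm
    refine this.congr fun n => ?_
    rw [norm_mul, norm_pow, Complex.norm_real, Complex.norm_real, norm_norm,
      Real.norm_of_nonneg (hc0 n)]
  have key := hasSum_integral_of_summable_integral_norm (μ := ρ)
    (F := fun (n : ℕ) (t : unitInterval) => (c n : ℂ) * (((t : ℝ) : ℂ) * z) ^ n)
    (fun n => integrable_unitInterval_of_continuous (by fun_prop)) (by
      refine Summable.of_nonneg_of_le (fun n => integral_nonneg fun t => norm_nonneg _)
        (fun n => ?_) (hsum.mul_right (ρ.real Set.univ))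
      calc _ ≤ ∫ _, c n * ‖z‖ ^ n ∂ρ := by
            refine integral_mono (integrable_unitInterval_of_continuous (by fun_prop))
              (integrable_const _) fun t => ?_
            simp only [norm_mul, norm_pow, Complex.norm_real, Real.norm_of_nonneg (hc0 n),
              Real.norm_of_nonneg t.2.1]
            refine mul_le_mul_of_nonneg_left ?_ (hc0 n)
            exact pow_le_pow_left₀ (mul_nonneg t.2.1 (norm_nonneg z))
              (mul_le_of_le_one_left (norm_nonneg z) t.2.2) n
        _ = _ := by simp [mul_comm])
  have h1 : kernelIntegral ρ 0 (-(σ : ℂ)) z =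
      ∫ t : unitInterval, ∑' n, (c n : ℂ) * (((t : ℝ) : ℂ) * z) ^ n ∂ρ := by
    refine integral_congr_ae (Eventually.of_forall fun t => ?_)
    simp only [pow_zero, one_mul]
    exact (hasSum_one_sub_cpow σ (htz t)).tsum_eq.symm
  rw [h1]
  have h2 : ∀ n, (hypergeometricCoeff σ a b n : ℂ) * z ^ n =
      ∫ t : unitInterval, (c n : ℂ) * (((t : ℝ) : ℂ) * z) ^ n ∂ρ := fun n => by
    have h3 : ∀ t : unitInterval, (c n : ℂ) * (((t : ℝ) : ℂ) * z) ^ n =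
        ((c n : ℂ) * z ^ n) * (((t : ℝ) ^ n : ℝ) : ℂ) := fun t => by push_cast; ring
    simp only [h3]
    rw [integral_const_mul, integral_complex_ofReal, hρ, hypergeometricCoeff, hc,
      Finset.prod_div_distrib]
    push_cast
    ring
  simp only [h2]
  exact key

theorem WeaklySupermajorized.isHypergeometricFunction_hypergeometricF {q : ℕ} {σ : ℝ}
    {a b : Fin q → ℝ} (hσ : 0 < σ) (hba : WeaklySupermajorized b a) :
    IsHypergeometricFunction σ a b (hypergeometricF σ a b) := by
  -- Only existence matters here, so the trivial exponent `0 / 1` is enough.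
  obtain ⟨ρ, hfin, hρ, -⟩ := hba.exists_moment_measure (σ := σ) (N := 1) (p := 0) one_pos
    (fun i => by simpa using hba.pos_a i) (by simpa using hσ.le)
  exact Classical.epsilon_spec ⟨_, isHypergeometricFunction_kernelIntegral hσ hρ⟩

/-! ### Stieltjes classes and a lower bound on decay -/

theorem one_sub_neg_mem_slitPlane {z : ℂ} (hz : z ∈ Complex.slitPlane) :
    1 - -z ∈ Complex.slitPlane := by
  rw [Complex.mem_slitPlane_iff] at hz ⊢
  simp only [sub_neg_eq_add, Complex.add_re, Complex.one_re, Complex.add_im, Complex.one_im,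
    zero_add]
  exact hz.imp (fun h => by linarith) id

theorem stieltjesFormMul_kernelIntegral_neg (ρ : Measure unitInterval) [IsFiniteMeasure ρ]
    (σ : ℝ) {f : ℂ → ℂ}
    (hf : ∀ z ∈ Complex.slitPlane, f z = kernelIntegral ρ 0 (-(σ : ℂ)) (-z)) :
    StieltjesFormMul σ f := by
  have hemb : MeasurableEmbedding (Subtype.val : unitInterval → ℝ) :=
    MeasurableEmbedding.subtype_coe measurableSet_Icc
  have hres : (ρ.map (Subtype.val : unitInterval → ℝ)).restrict (Set.Ici 0) =
      ρ.map (Subtype.val : unitInterval → ℝ) := by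
    refine Measure.restrict_eq_self_of_ae_mem ?_
    rw [hemb.ae_map_iff]
    exact Eventually.of_forall fun t => t.2.1
  have hk : ∀ (z : ℂ) (t : unitInterval), 1 / (1 + ((t : ℝ) : ℂ) * z) ^ (σ : ℂ) =
      ((t : ℝ) : ℂ) ^ 0 * (1 - (t : ℝ) * -z) ^ (-(σ : ℂ)) := fun z t => by
    rw [Complex.cpow_neg, pow_zero, one_mul, one_div, mul_neg, sub_neg_eq_add]
  refine ⟨0, ρ.map (Subtype.val : unitInterval → ℝ), le_rfl, fun z hz => ?_⟩
  rw [IntegrableOn, hres, hemb.integrable_map_iff, hemb.integral_map, hf z hz]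
  simp only [Function.comp_def, hk]
  refine ⟨integrable_unitInterval_of_continuous
    (continuous_pow_mul_one_sub_cpow 0 _ (one_sub_neg_mem_slitPlane hz)), ?_⟩
  simp [kernelIntegral]

theorem kernelIntegral_neg_ofReal (ρ : Measure unitInterval) (k : ℕ) (β : ℝ) {x : ℝ}
    (hx : 0 ≤ x) : kernelIntegral ρ k (β : ℂ) (-(x : ℂ)) =
      ((∫ t : unitInterval, (t : ℝ) ^ k * (1 + (t : ℝ) * x) ^ β ∂ρ : ℝ) : ℂ) := by
  rw [← integral_complex_ofReal, kernelIntegral]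
  congr 1
  funext t
  have h : 0 ≤ 1 + (t : ℝ) * x := add_nonneg zero_le_one (mul_nonneg t.2.1 hx)
  rw [Complex.ofReal_mul, Complex.ofReal_cpow h]
  push_cast
  rw [mul_neg, sub_neg_eq_add]

theorem mul_re_setIntegral_le {μ : Measure ℝ} {f g : ℝ → ℂ} {c : ℝ}
    (hf : IntegrableOn f (Set.Ici 0) μ) (hg : IntegrableOn g (Set.Ici 0) μ)
    (hfg : ∀ u, 0 ≤ u → c * (f u).re ≤ (g u).re) :
    c * (∫ u in Set.Ici (0 : ℝ), f u ∂μ).re ≤ (∫ u in Set.Ici (0 : ℝ), g u ∂μ).re := by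
  have h := setIntegral_mono_on (hf.re.const_mul c) hg.re measurableSet_Ici
    fun u hu => hfg u hu
  rw [integral_const_mul] at h
  have e1 : ∫ u in Set.Ici (0 : ℝ), RCLike.re (f u) ∂μ = (∫ u in Set.Ici (0 : ℝ), f u ∂μ).re :=
    integral_re hf
  have e2 : ∫ u in Set.Ici (0 : ℝ), RCLike.re (g u) ∂μ = (∫ u in Set.Ici (0 : ℝ), g u ∂μ).re :=
    integral_re hg
  rwa [e1, e2] at h

theorem re_one_div_ofReal_cpow {y : ℝ} (hy : 0 ≤ y) (α : ℝ) :
    (1 / (y : ℂ) ^ (α : ℂ)).re = y ^ (-α) := by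
  rw [← Complex.ofReal_cpow hy, ← Complex.ofReal_one, ← Complex.ofReal_div, Complex.ofReal_re,
    Real.rpow_neg hy, one_div]

/-- For `x ≥ 1` the kernels compare pointwise, because `u + x ≤ x (u + 1)` and `1 + t x ≤ x (1 +
t)`; the constant terms obey the same bound. -/
theorem rpow_neg_mul_re_le_of_mem_stieltjesClass {α : ℝ} {f : ℂ → ℂ} (hf : f ∈ stieltjesClass α)
    {x : ℝ} (hx : 1 ≤ x) : x ^ (-α) * (f 1).re ≤ (f x).re := by
  obtain ⟨hα, hf⟩ := hf
  have hx0 : 0 < x := one_pos.trans_le hx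
  have hxs : (x : ℂ) ∈ Complex.slitPlane := Complex.ofReal_mem_slitPlane.2 hx0
  have hmono : ∀ y z : ℝ, 0 < y → 0 < z → z ≤ x * y → x ^ (-α) * y ^ (-α) ≤ z ^ (-α) :=
    fun y z hy hz hzy => by
      rw [← Real.mul_rpow hx0.le hy.le]
      exact Real.rpow_le_rpow_of_nonpos hz hzy (by linarith)
  rcases hf with ⟨C, μ, hC, h⟩ | ⟨C, μ, hC, h⟩
  · have h1 := h 1 Complex.one_mem_slitPlane
    have h2 := h x hxs
    have h3 := mul_re_setIntegral_le (c := x ^ (-α)) h1.1 h2.1 fun u hu => by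
      rw [← Complex.ofReal_one, ← Complex.ofReal_add, ← Complex.ofReal_add, Complex.ofReal_one,
        re_one_div_ofReal_cpow (by positivity), re_one_div_ofReal_cpow (by positivity)]
      exact hmono _ _ (by positivity) (by positivity) (by nlinarith)
    rw [h1.2, h2.2, Complex.add_re, Complex.add_re, Complex.ofReal_re, mul_add]
    refine add_le_add (mul_le_of_le_one_left hC ?_) h3
    exact Real.rpow_le_one_of_one_le_of_nonpos hx (by linarith)
  · have h1 := h 1 Complex.one_mem_slitPlane
    have h2 := h x hxs
    have h3 := mul_re_setIntegral_le (c := x ^ (-α)) h1.1 h2.1 fun u hu => by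
      rw [mul_one, ← Complex.ofReal_one, ← Complex.ofReal_mul, ← Complex.ofReal_add,
        ← Complex.ofReal_add, Complex.ofReal_one,
        re_one_div_ofReal_cpow (by positivity), re_one_div_ofReal_cpow (by positivity)]
      exact hmono _ _ (by positivity) (by positivity) (by nlinarith)
    have e : (C / (x : ℂ) ^ (α : ℂ)).re = C * x ^ (-α) := by
      rw [← re_one_div_ofReal_cpow hx0.le, ← Complex.re_ofReal_mul, mul_one_div]
    rw [h1.2, h2.2, Complex.add_re, Complex.add_re, e, Complex.one_cpow, div_one,
      Complex.ofReal_re, mul_add, mul_comm C]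
    exact add_le_add h3 le_rfl

theorem not_mem_stieltjesClass_of_le_rpow {f : ℂ → ℂ} {α s K : ℝ} (hαs : α < s)
    (hf1 : 0 < (f 1).re) (hf : ∀ x : ℝ, 0 < x → (f x).re ≤ K * x ^ (-s)) :
    f ∉ stieltjesClass α := by
  intro h
  have hb : ∀ᶠ x : ℝ in atTop, (f 1).re ≤ K * x ^ (-(s - α)) := by
    filter_upwards [eventually_ge_atTop 1] with x hx
    have hx0 : 0 < x := one_pos.trans_le hx
    have h1 := (rpow_neg_mul_re_le_of_mem_stieltjesClass h hx).trans (hf x hx0)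
    rw [show -(s - α) = -s + α by ring, Real.rpow_add hx0, ← mul_assoc]
    rwa [Real.rpow_neg hx0.le, inv_mul_le_iff₀ (Real.rpow_pos_of_pos hx0 α), mul_comm] at h1
  have hlim := (tendsto_rpow_neg_atTop (sub_pos.2 hαs)).const_mul K
  rw [mul_zero] at hlim
  exact absurd (ge_of_tendsto hlim hb) (not_le.2 hf1)

/-! ### Complete monotonicity -/

theorem hasDerivAt_re_kernelIntegral_neg (ρ : Measure unitInterval) [IsFiniteMeasure ρ] (k : ℕ)
    (β : ℝ) {x : ℝ} (hx : 0 < x) :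
    HasDerivAt (fun x : ℝ => (kernelIntegral ρ k (β : ℂ) (-(x : ℂ))).re)
      (β * (kernelIntegral ρ (k + 1) ((β - 1 : ℝ) : ℂ) (-(x : ℂ))).re) x := by
  have h1 := (hasDerivAt_kernelIntegral ρ k (β : ℂ)
    (one_sub_neg_mem_slitPlane (Complex.ofReal_mem_slitPlane.2 hx))).comp (x : ℂ)
    (hasDerivAt_neg (x : ℂ))
  have h2 := h1.real_of_complex
  refine h2.congr_deriv ?_
  push_cast
  rw [mul_neg_one, neg_mul, neg_neg, Complex.re_ofReal_mul]

theorem iteratedDeriv_re_kernelIntegral_neg (ρ : Measure unitInterval) [IsFiniteMeasure ρ]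
    (σ : ℝ) {g : ℝ → ℝ}
    (hg : ∀ x : ℝ, 0 < x → g x = (kernelIntegral ρ 0 ((-σ : ℝ) : ℂ) (-(x : ℂ))).re)
    (n : ℕ) {x : ℝ} (hx : 0 < x) :
    iteratedDeriv n g x = (-1) ^ n * risingFactorial σ n *
      (kernelIntegral ρ n ((-σ - n : ℝ) : ℂ) (-(x : ℂ))).re := by
  induction n generalizing x with
  | zero => simpa [risingFactorial] using hg x hx
  | succ n ih =>
    rw [iteratedDeriv_succ]
    have he : iteratedDeriv n g =ᶠ[nhds x] fun x => (-1) ^ n * risingFactorial σ n *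
        (kernelIntegral ρ n ((-σ - n : ℝ) : ℂ) (-(x : ℂ))).re := by
      filter_upwards [lt_mem_nhds hx] with y hy
      exact ih hy
    rw [he.deriv_eq, ((hasDerivAt_re_kernelIntegral_neg ρ n (-σ - n) hx).const_mul _).deriv,
      risingFactorial, risingFactorial, ascPochhammer_succ_eval, Nat.cast_succ,
      show -σ - ((n : ℝ) + 1) = -σ - n - 1 by ring]
    ring

theorem isCompletelyMonotonic_of_eq_kernelIntegral {ρ : Measure unitInterval} [IsFiniteMeasure ρ]
    {σ : ℝ} (hσ : 0 < σ) {g : ℝ → ℝ}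
    (hg : ∀ x : ℝ, 0 < x → g x = (kernelIntegral ρ 0 ((-σ : ℝ) : ℂ) (-(x : ℂ))).re) :
    IsCompletelyMonotonic g := by
  refine ⟨?_, fun n x hx => ?_⟩
  · have h1 : ContDiffOn ℂ ∞ (kernelIntegral ρ 0 ((-σ : ℝ) : ℂ))
        ((fun x : ℝ => (x : ℂ)) '' Set.Ici 1)ᶜ :=
      DifferentiableOn.contDiffOn (fun z hz => (hasDerivAt_kernelIntegral ρ 0 _
        (mem_cutPlane_iff.1 hz)).differentiableAt.differentiableWithinAt) isOpen_cutPlane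
    have h2 : ContDiff ℝ ∞ fun x : ℝ => -(x : ℂ) := Complex.ofRealCLM.contDiff.neg
    have h3 := Complex.reCLM.contDiff.comp_contDiffOn
      ((h1.restrict_scalars ℝ).comp h2.contDiffOn (s := Set.Ioi 0) fun x hx =>
        mem_cutPlane_iff.2 (one_sub_neg_mem_slitPlane (Complex.ofReal_mem_slitPlane.2 hx)))
    exact h3.congr fun x hx => hg x hx
  · rw [iteratedDeriv_re_kernelIntegral_neg ρ σ hg n hx, ← mul_assoc, ← mul_assoc, ← mul_pow,
      kernelIntegral_neg_ofReal ρ n _ hx.le, Complex.ofReal_re]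
    have hx' : (0 : ℝ) ≤ x := le_of_lt hx
    refine mul_nonneg (mul_nonneg (by norm_num) (risingFactorial_pos hσ n).le)
      (integral_nonneg fun t => mul_nonneg (pow_nonneg t.2.1 n) (Real.rpow_nonneg ?_ _))
    exact add_nonneg zero_le_one (mul_nonneg t.2.1 hx')

/-! ### Exact order and conclusion -/

theorem WeaklySupermajorized.exists_hypergeometricF_eq_kernelIntegral {q : ℕ} {σ : ℝ}
    {a b : Fin q → ℝ} (hσ : 0 < σ) (hba : WeaklySupermajorized b a) {N p : ℕ} (hN : 0 < N)
    (hp : ∀ i, (p : ℝ) / N < a i) (hpσ : (p : ℝ) / N ≤ σ) :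
    ∃ ρ : Measure unitInterval, IsFiniteMeasure ρ ∧
      (∀ z ∈ Complex.slitPlane,
        hypergeometricF σ a b (-z) = kernelIntegral ρ 0 ((-σ : ℝ) : ℂ) (-z)) ∧
      ρ ≠ 0 ∧ ∃ K : ℝ, ∀ x : ℝ, 0 < x →
        (hypergeometricF σ a b (-(x : ℂ))).re ≤ K * x ^ (-((p : ℝ) / N)) := by
  obtain ⟨ρ, hfin, hρ, K, hK⟩ := hba.exists_moment_measure hN hp hpσ
  have heq : ∀ z ∈ Complex.slitPlane,
      hypergeometricF σ a b (-z) = kernelIntegral ρ 0 ((-σ : ℝ) : ℂ) (-z) := fun z hz => by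
    rw [Complex.ofReal_neg]
    exact (hba.isHypergeometricFunction_hypergeometricF hσ).eqOn
      (isHypergeometricFunction_kernelIntegral hσ hρ)
      (mem_cutPlane_iff.2 (one_sub_neg_mem_slitPlane hz))
  refine ⟨ρ, hfin, heq, ?_, K, fun x hx => ?_⟩
  -- The zeroth moment is the empty-factor quotient `1`, which the zero measure cannot have.
  · rintro rfl
    have := hρ 0
    simp [risingFactorial] at this
  · rw [heq _ (Complex.ofReal_mem_slitPlane.2 hx), kernelIntegral_neg_ofReal ρ 0 _ hx.le,
      Complex.ofReal_re]
    simpa using hK x hx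

theorem re_kernelIntegral_neg_pos {ρ : Measure unitInterval} [IsFiniteMeasure ρ] (hρ : ρ ≠ 0)
    (β : ℝ) {x : ℝ} (hx : 0 < x) : 0 < (kernelIntegral ρ 0 (β : ℂ) (-(x : ℂ))).re := by
  have hpos : ∀ t : unitInterval, 0 < 1 + (t : ℝ) * x := fun t =>
    add_pos_of_pos_of_nonneg one_pos (mul_nonneg t.2.1 hx.le)
  have hc : Continuous fun t : unitInterval => (t : ℝ) ^ 0 * (1 + (t : ℝ) * x) ^ β :=
    Continuous.mul (by fun_prop)
      (Continuous.rpow_const (by fun_prop) fun t => Or.inl (hpos t).ne')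
  have hp : ∀ t : unitInterval, 0 < (t : ℝ) ^ 0 * (1 + (t : ℝ) * x) ^ β := fun t => by
    rw [pow_zero, one_mul]
    exact Real.rpow_pos_of_pos (hpos t) β
  rw [kernelIntegral_neg_ofReal ρ 0 β hx.le, Complex.ofReal_re,
    integral_pos_iff_support_of_nonneg (fun t => (hp t).le)
      (integrable_unitInterval_of_continuous hc),
    Function.support_eq_univ fun t => (hp t).ne']
  exact pos_iff_ne_zero.2 (Measure.measure_univ_ne_zero.2 hρ)

theorem exists_nat_div_between {α σ : ℝ} (hα : 0 < α) (hασ : α < σ) :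
    ∃ N p : ℕ, 0 < N ∧ α < (p : ℝ) / N ∧ (p : ℝ) / N < σ := by
  obtain ⟨r, h1, h2⟩ := exists_rat_btwn hασ
  have hr : 0 < r := by exact_mod_cast hα.trans h1
  refine ⟨r.den, r.num.toNat, r.den_pos, ?_⟩
  have e : ((r.num.toNat : ℕ) : ℝ) / r.den = (r : ℝ) := by
    have h3 : ((r.num.toNat : ℕ) : ℤ) = r.num := Int.toNat_of_nonneg (Rat.num_nonneg.2 hr.le)
    have h4 : ((r.num.toNat : ℕ) : ℝ) = (r.num : ℝ) := by exact_mod_cast h3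
    rw [Rat.cast_def, h4]
  rw [e]
  exact ⟨h1, h2⟩

theorem mainTheorem2 (q : ℕ) (hq : 1 ≤ q) (σ : ℝ) (a b : Fin q → ℝ)
    (hσ : 0 < σ) (hσa : ∀ i, σ ≤ a i) (hba : WeaklySupermajorized b a) :
    IsHypergeometricFunction σ a b (hypergeometricF σ a b) ∧
    (fun z : ℂ => hypergeometricF σ a b (-z)) ∈ stieltjesClass σ ∧
    IsExactStieltjesOrder (fun z : ℂ => hypergeometricF σ a b (-z)) σ ∧
    (∀ x : ℝ, 0 < x → (hypergeometricF σ a b (-(x : ℂ))).im = 0) ∧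
    IsCompletelyMonotonic (fun x : ℝ => (hypergeometricF σ a b (-(x : ℂ))).re) := by
  obtain ⟨ρ, hfin, heq, hρ, -⟩ := hba.exists_hypergeometricF_eq_kernelIntegral hσ (N := 1) (p := 0)
    one_pos (fun i => by simpa using hba.pos_a i) (by simpa using hσ.le)
  have hmem : (fun z : ℂ => hypergeometricF σ a b (-z)) ∈ stieltjesClass σ :=
    ⟨hσ, Or.inr (stieltjesFormMul_kernelIntegral_neg ρ σ fun z hz => by
      rw [heq z hz, Complex.ofReal_neg])⟩
  have hreal : ∀ x : ℝ, 0 < x → hypergeometricF σ a b (-(x : ℂ)) =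
      kernelIntegral ρ 0 ((-σ : ℝ) : ℂ) (-(x : ℂ)) := fun x hx =>
    heq _ (Complex.ofReal_mem_slitPlane.2 hx)
  refine ⟨hba.isHypergeometricFunction_hypergeometricF hσ, hmem,
    ⟨⟨σ, hmem⟩, fun α hα => ?_, fun c hc => hc hmem⟩, fun x hx => ?_, ?_⟩
  · by_contra! hlt
    -- An order `α < σ` leaves room for a rational `p / N` strictly between; the decay `x ^ (-p /
    -- N)` is then too fast for `S_α`. Here `σ ≤ a i` ensures `p / N < a i`.
    obtain ⟨N, p, hN, h1, h2⟩ := exists_nat_div_between hα.1 hlt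
    obtain ⟨-, -, -, -, K, hK⟩ := hba.exists_hypergeometricF_eq_kernelIntegral hσ hN
      (fun i => h2.trans_le (hσa i)) h2.le
    refine not_mem_stieltjesClass_of_le_rpow h1 ?_ hK hα
    rw [← Complex.ofReal_one, hreal 1 one_pos]
    exact re_kernelIntegral_neg_pos hρ _ one_pos
  · rw [hreal x hx, kernelIntegral_neg_ofReal ρ 0 _ hx.le, Complex.ofReal_im]
  · exact isCompletelyMonotonic_of_eq_kernelIntegral hσ fun x hx => by rw [hreal x hx]
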